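/- Let $V:(-\infty,0]\to[0,\infty)$ be continuous with $V(x)\to 0$ as $x\to-\infty$. For $\gamma\in\mathbb R$ let ${}^{\gamma}\mathcal H$ be the operator $\psi\mapsto-\psi''+V\psi$ in $L^2((-\infty,0),dx)$ whose domain consists of all $\psi\in L^2((-\infty,0))$ that are $C^1$ on $(-\infty,0]$ with locally absolutely continuous derivative, satisfy $-\psi''+V\psi\in L^2((-\infty,0))$, and obey the Robin boundary condition $\psi'(0)=\gamma\,\psi(0)$. Then: (i) If $V$ is not identically zero, there is $\gamma_0>0$ such that ${}^{\gamma}\mathcal H$ has no negative eigenvalue for $0<\gamma<\gamma_0$. (ii) There is a critical value $\gamma_c\ge 0$, with $\gamma_c>0$ if $V$ is not identically zero, such that $\{\gamma\in\mathbb R : {}^{\gamma}\mathcal H \text{ has a negative eigenvalue}\}=(\gamma_c,\infty)$. (iii) For every $\gamma>\gamma_c$ the operator ${}^{\gamma}\mathcal H$ has exactly one negative eigenvalue $E_\gamma$, and $|E_\gamma|\le 2\gamma^2$. (iv) If $\int_{-\infty}^0V\,dx<\infty$, then $\gamma_c\le 2\int_{-\infty}^0V\,dx$. -/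

import Mathlib

open Set Filter Topology MeasureTheory

noncomputable section

namespace RobinHalfLine

/-- The Hilbert space `L²((-∞,0), dx)` of complex valued functions. -/
abbrev HalfLineL2 : Type := Lp ℂ 2 (volume.restrict (Iio (0 : ℝ)))

/-- On `(-∞,0]`, `u` is continuously differentiable with derivative `v`, and `v` is locally
absolutely continuous (up to the end point `0`) with almost everywhere derivative `w`. -/
structure IsSecondPrimitive (u v w : ℝ → ℂ) : Prop where
  intervalIntegrable : ∀ x ≤ 0, IntervalIntegrable w volume x 0
  first : ∀ x ≤ 0, v x = v 0 - ∫ t in x..0, w t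
  zeroth : ∀ x ≤ 0, u x = u 0 - ∫ t in x..0, v t

theorem continuousOn_of_primitive {v w : ℝ → ℂ}
    (hw : ∀ x ≤ 0, IntervalIntegrable w volume x 0)
    (hv : ∀ x ≤ 0, v x = v 0 - ∫ t in x..0, w t) : ContinuousOn v (Iic 0) := by
  have key : ∀ a ≤ 0, ContinuousOn v (Icc a 0) := by
    intro a ha
    have h1 : ContinuousOn (fun x => ∫ t in (0 : ℝ)..x, w t) (uIcc a 0) :=
      intervalIntegral.continuousOn_primitive_interval' (hw a ha) right_mem_uIcc
    rw [uIcc_of_le ha] at h1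
    refine (h1.const_add (v 0)).congr fun x hx => ?_
    rw [hv x hx.2, intervalIntegral.integral_symm, sub_neg_eq_add, intervalIntegral.integral_symm,
      intervalIntegral.integral_symm]
    simp
  intro x hx
  have hx0 : x ≤ 0 := hx
  have h := key (x - 1) (by linarith) x ⟨by linarith, hx0⟩
  refine h.mono_of_mem_nhdsWithin ?_
  have : Ioi (x - 1) ∩ Iic 0 ∈ 𝓝[Iic 0] x :=
    inter_mem (mem_nhdsWithin_of_mem_nhds (Ioi_mem_nhds (by linarith))) self_mem_nhdsWithin
  exact mem_of_superset this fun y hy => ⟨le_of_lt hy.1, hy.2⟩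

theorem intervalIntegrable_of_continuousOn {v : ℝ → ℂ} (hv : ContinuousOn v (Iic 0)) :
    ∀ x ≤ 0, IntervalIntegrable v volume x 0 := by
  intro x hx
  apply ContinuousOn.intervalIntegrable
  rw [uIcc_of_le hx]
  exact hv.mono fun y hy => hy.2

theorem IsSecondPrimitive.continuousOn_first {u v w : ℝ → ℂ} (h : IsSecondPrimitive u v w) :
    ContinuousOn v (Iic 0) :=
  continuousOn_of_primitive h.intervalIntegrable h.first

theorem IsSecondPrimitive.continuousOn_zeroth {u v w : ℝ → ℂ} (h : IsSecondPrimitive u v w) :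
    ContinuousOn u (Iic 0) :=
  continuousOn_of_primitive (intervalIntegrable_of_continuousOn h.continuousOn_first) h.zeroth

theorem ae_eq_zero_of_primitive_eq_zero {w : ℝ → ℂ}
    (hw : ∀ x ≤ 0, IntervalIntegrable w volume x 0)
    (h0 : ∀ x ≤ 0, ∫ t in x..0, w t = 0) : ∀ᵐ x ∂(volume.restrict (Iio (0 : ℝ))), w x = 0 := by
  rw [ae_restrict_iff' measurableSet_Iio]
  have h1 : ∀ n : ℕ, ∀ᵐ x : ℝ, x ∈ uIcc (-(n : ℝ)) 0 → ∀ c ∈ uIcc (-(n : ℝ)) 0,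
      HasDerivAt (fun x => ∫ t in c..x, w t) (w x) x := fun n =>
    (hw (-(n : ℝ)) (by simp)).ae_hasDerivAt_integral
  filter_upwards [ae_all_iff.2 h1] with x hx hx0
  obtain ⟨n, hn⟩ := exists_nat_gt (-x)
  have hxlt : x < 0 := hx0
  have hd := hx n (by rw [uIcc_of_le (by simp)]; exact ⟨by linarith, hxlt.le⟩) 0 right_mem_uIcc
  have hz : (fun y => ∫ t in (0 : ℝ)..y, w t) =ᶠ[𝓝 x] fun _ => 0 := by
    filter_upwards [Iio_mem_nhds hxlt] with y hy
    rw [intervalIntegral.integral_symm, h0 y (le_of_lt hy), neg_zero]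
  exact hd.unique ((hasDerivAt_const x (0 : ℂ)).congr_of_eventuallyEq hz)

theorem eq_zero_of_ae_eq_zero {u : ℝ → ℂ} (hu : ContinuousOn u (Iic 0))
    (h : ∀ᵐ x ∂(volume.restrict (Iio (0 : ℝ))), u x = 0) : ∀ x ≤ 0, u x = 0 := by
  have h' : u =ᵐ[volume.restrict (Iic (0 : ℝ))] fun _ => 0 := by
    rw [← restrict_Iio_eq_restrict_Iic]; exact h
  have := Measure.eqOn_of_ae_eq h' hu continuousOn_const (by simp)
  exact fun x hx => this hx

theorem IsSecondPrimitive.ae_eq_zero {u v w : ℝ → ℂ} (h : IsSecondPrimitive u v w)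
    (hu : ∀ᵐ x ∂(volume.restrict (Iio (0 : ℝ))), u x = 0) :
    ∀ᵐ x ∂(volume.restrict (Iio (0 : ℝ))), w x = 0 := by
  have hu0 := eq_zero_of_ae_eq_zero h.continuousOn_zeroth hu
  have hv0 : ∀ x ≤ 0, v x = 0 := by
    refine eq_zero_of_ae_eq_zero h.continuousOn_first (ae_eq_zero_of_primitive_eq_zero
      (intervalIntegrable_of_continuousOn h.continuousOn_first) fun x hx => ?_)
    have := h.zeroth x hx
    rw [hu0 x hx, hu0 0 le_rfl] at this
    simpa using this.symm
  refine ae_eq_zero_of_primitive_eq_zero h.intervalIntegrable fun x hx => ?_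
  have := h.first x hx
  rw [hv0 x hx, hv0 0 le_rfl] at this
  simpa using this.symm

/-- The graph of the Robin Hamiltonian: the pairs `(f, -f'' + V f)` of elements of `L²((-∞,0))`
such that `f` has a `C¹` representative `u` on `(-∞,0]` with locally absolutely continuous
derivative and `u'(0) = γ u(0)`. -/
def robinGraph (V : ℝ → ℝ) (γ : ℝ) : Submodule ℂ (HalfLineL2 × HalfLineL2) where
  carrier := {p | ∃ u v w : ℝ → ℂ, IsSecondPrimitive u v w ∧
    (∀ᵐ x ∂(volume.restrict (Iio (0 : ℝ))), p.1 x = u x) ∧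
    (∀ᵐ x ∂(volume.restrict (Iio (0 : ℝ))), p.2 x = -w x + (V x : ℂ) * u x) ∧
    v 0 = (γ : ℂ) * u 0}
  zero_mem' := by
    refine ⟨0, 0, 0, ⟨fun x _ => intervalIntegrable_const, by simp, by simp⟩, ?_, ?_, by simp⟩
    · filter_upwards [Lp.coeFn_zero ℂ 2 (volume.restrict (Iio (0 : ℝ)))] with x hx
      simpa using hx
    · filter_upwards [Lp.coeFn_zero ℂ 2 (volume.restrict (Iio (0 : ℝ)))] with x hx
      simpa using hx
  add_mem' := by
    rintro p q ⟨u, v, w, h, h1, h2, h3⟩ ⟨u', v', w', h', h1', h2', h3'⟩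
    refine ⟨u + u', v + v', w + w', ⟨fun x hx => (h.intervalIntegrable x hx).add
      (h'.intervalIntegrable x hx), fun x hx => ?_, fun x hx => ?_⟩, ?_, ?_, ?_⟩
    · simp only [Pi.add_apply]
      rw [intervalIntegral.integral_add (h.intervalIntegrable x hx) (h'.intervalIntegrable x hx),
        h.first x hx, h'.first x hx]
      ring
    · simp only [Pi.add_apply]
      rw [intervalIntegral.integral_add
          (intervalIntegrable_of_continuousOn h.continuousOn_first x hx)
          (intervalIntegrable_of_continuousOn h'.continuousOn_first x hx),
        h.zeroth x hx, h'.zeroth x hx]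
      ring
    · filter_upwards [h1, h1', Lp.coeFn_add p.1 q.1] with x a b c
      rw [Prod.fst_add, c, Pi.add_apply, a, b, Pi.add_apply]
    · filter_upwards [h2, h2', Lp.coeFn_add p.2 q.2] with x a b c
      rw [Prod.snd_add, c, Pi.add_apply, a, b, Pi.add_apply, Pi.add_apply]
      ring
    · simp only [Pi.add_apply, h3, h3']
      ring
  smul_mem' := by
    rintro c p ⟨u, v, w, h, h1, h2, h3⟩
    refine ⟨c • u, c • v, c • w, ⟨fun x hx => (h.intervalIntegrable x hx).const_mul c,
      fun x hx => ?_, fun x hx => ?_⟩, ?_, ?_, ?_⟩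
    · simp only [Pi.smul_apply, smul_eq_mul]
      rw [intervalIntegral.integral_const_mul, h.first x hx]
      ring
    · simp only [Pi.smul_apply, smul_eq_mul]
      rw [intervalIntegral.integral_const_mul, h.zeroth x hx]
      ring
    · filter_upwards [h1, Lp.coeFn_smul c p.1] with x a b
      rw [Prod.smul_fst, b, Pi.smul_apply, a, Pi.smul_apply]
    · filter_upwards [h2, Lp.coeFn_smul c p.2] with x a b
      rw [Prod.smul_snd, b, Pi.smul_apply, a, Pi.smul_apply, Pi.smul_apply]
      simp only [smul_eq_mul]
      ring
    · simp only [Pi.smul_apply, smul_eq_mul, h3]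
      ring

/-- The graph is single valued: the value `-f'' + V f` is determined by `f`. -/
theorem robinGraph_singleValued (V : ℝ → ℝ) (γ : ℝ) :
    ∀ p : HalfLineL2 × HalfLineL2, p ∈ robinGraph V γ → p.1 = 0 → p.2 = 0 := by
  rintro p ⟨u, v, w, h, h1, h2, -⟩ hp
  have hu : ∀ᵐ x ∂(volume.restrict (Iio (0 : ℝ))), u x = 0 := by
    have h0 : ∀ᵐ x ∂(volume.restrict (Iio (0 : ℝ))), p.1 x = 0 := by
      rw [hp]
      exact Lp.coeFn_zero ℂ 2 (volume.restrict (Iio (0 : ℝ)))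
    filter_upwards [h1, h0] with x a b
    rw [← a, b]
  rw [Lp.eq_zero_iff_ae_eq_zero]
  filter_upwards [h2, hu, h.ae_eq_zero hu] with x a b c
  rw [a, b, c]
  simp

/-- The Hamiltonian `-d²/dx² + V` on `L²((-∞,0))` with boundary condition `ψ'(0) = γ ψ(0)`,
as an unbounded operator; its domain consists of all `ψ ∈ L²` which are `C¹` on `(-∞,0]` with
locally absolutely continuous derivative, satisfy the boundary condition, and are such that
`-ψ'' + V ψ ∈ L²`. -/
def robinHamiltonian (V : ℝ → ℝ) (γ : ℝ) : HalfLineL2 →ₗ.[ℂ] HalfLineL2 :=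
  (robinGraph V γ).toLinearPMap

/-- `robinHamiltonian` has the intended graph. -/
theorem robinHamiltonian_graph (V : ℝ → ℝ) (γ : ℝ) :
    (robinHamiltonian V γ).graph = robinGraph V γ :=
  Submodule.toLinearPMap_graph_eq _ (robinGraph_singleValued V γ)

/-- `μ` is an eigenvalue of the unbounded operator `T`. -/
def IsEigenvalue (T : HalfLineL2 →ₗ.[ℂ] HalfLineL2) (μ : ℂ) : Prop :=
  ∃ f : T.domain, (f : HalfLineL2) ≠ 0 ∧ T f = μ • (f : HalfLineL2)

/-- The (real) number `E` is a negative eigenvalue of the Robin Hamiltonian. -/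
def IsNegativeEigenvalue (V : ℝ → ℝ) (γ E : ℝ) : Prop :=
  E < 0 ∧ IsEigenvalue (robinHamiltonian V γ) (E : ℂ)

end RobinHalfLine

end

/-! For each `k > 0` the equation `u'' = (V + k) u` has, up to scaling, one solution that stays
bounded at `-∞`. Normalise it by `u 0 = 1` and put `m k = u' 0`. Square-integrable solutions are
bounded ones, so `-k` is an eigenvalue for the parameter `γ` exactly when `m k = γ`, and everything
reduces to properties of the function `m`.

The distinction between decay and growth rests on `(u u')' = u'² + (V + k) u² ≥ 0`: if `u u'` is
negative somewhere, then `u²` grows at least linearly towards `-∞`. So the decaying solution is the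
one with `u u' ≥ 0`, and it, like its derivative, is nonnegative, nondecreasing and tends to `0`.
Its existence comes from a contraction built on the Green kernel of `-d²/dx² + (k + M)`, where `M`
bounds `V`.

Functions that vanish at `-∞` and have a signed derivative then give all estimates: Wronskians show
that `m` is strictly increasing (`first_lt`) and `m k / k` nonincreasing (`mul_first_le`), hence `m`
is continuous; `v² - k u²` gives `k ≤ m k ^ 2`; `v - √k u` gives `m k ≤ ∫ V + √k`. The range of `m`
is therefore `(γc, ∞)` with `γc = inf m`, which is positive when `V ≠ 0` by `exists_lower_bound`. -/

noncomputable section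

namespace RobinHalfLine

/-! ### Real solutions and the growth dichotomy at `-∞` -/

/-- On `(-∞,0]`, `u` is a real solution of `u'' = (V + k) u` with derivative `v`. -/
structure IsSolution (V : ℝ → ℝ) (k : ℝ) (u v : ℝ → ℝ) : Prop where
  deriv_zeroth : ∀ x ≤ 0, HasDerivWithinAt u (v x) (Iic 0) x
  deriv_first : ∀ x ≤ 0, HasDerivWithinAt v ((V x + k) * u x) (Iic 0) x

/-- A solution with `u 0 = 1` whose square is nondecreasing; this singles out the solution that
decays at `-∞`. -/
structure IsRecessive (V : ℝ → ℝ) (k : ℝ) (u v : ℝ → ℝ) : Prop extends IsSolution V k u v where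
  mul_nonneg : ∀ x ≤ 0, 0 ≤ u x * v x
  apply_zero : u 0 = 1

/-- Growth estimates below come from this comparison, typically with a linear function or a
primitive of `V` on one side. -/
theorem sub_le_sub_of_deriv_le {f g f' g' : ℝ → ℝ} {b : ℝ} (hb : b ≤ 0)
    (hf : ∀ x ≤ 0, HasDerivWithinAt f (f' x) (Iic 0) x)
    (hg : ∀ x ≤ 0, HasDerivWithinAt g (g' x) (Iic 0) x)
    {a : ℝ} (hab : a ≤ b) (h : ∀ x ∈ Ioo a b, f' x ≤ g' x) : f b - f a ≤ g b - g a := by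
  have hd : ∀ x ≤ 0, HasDerivWithinAt (fun x => g x - f x) (g' x - f' x) (Iic 0) x :=
    fun x hx => (hg x hx).sub (hf x hx)
  have hmono : MonotoneOn (fun x => g x - f x) (Icc a b) := by
    refine monotoneOn_of_hasDerivWithinAt_nonneg (f' := fun x => g' x - f' x) (convex_Icc a b)
      (fun x hx => ((hd x (hx.2.trans hb)).continuousWithinAt).mono fun y hy => hy.2.trans hb) ?_ ?_
    · intro x hx
      rw [interior_Icc] at hx ⊢
      exact (hd x (hx.2.le.trans hb)).mono fun y hy => hy.2.le.trans hb
    · intro x hx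
      rw [interior_Icc] at hx
      linarith [h x hx]
  have := hmono (left_mem_Icc.2 hab) (right_mem_Icc.2 hab) hab
  simp only at this
  linarith

theorem monotoneOn_Iic_of_deriv_nonneg {f f' : ℝ → ℝ}
    (hf : ∀ x ≤ 0, HasDerivWithinAt f (f' x) (Iic 0) x) (h : ∀ x ≤ 0, 0 ≤ f' x) :
    MonotoneOn f (Iic 0) := by
  intro a _ b hb hab
  have := sub_le_sub_of_deriv_le hb (fun x _ => hasDerivWithinAt_const x (Iic 0) (0 : ℝ)) hf hab
    fun x hx => h x (hx.2.le.trans hb)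
  linarith

/-- A nondecreasing function on `(-∞,0]` is bounded below by its limit at `-∞`. -/
theorem le_of_tendsto_atBot {f : ℝ → ℝ} {l : ℝ} (hf : MonotoneOn f (Iic 0))
    (hl : Tendsto f atBot (𝓝 l)) (x : ℝ) (hx : x ≤ 0) : l ≤ f x :=
  le_of_tendsto hl <| (eventually_le_atBot x).mono fun _ hy => hf (hy.trans hx) hx hy

/-- Freezing the integrand at its value at `0` for positive arguments makes it continuous on the
whole line, so the two-sided fundamental theorem applies even at the end point. -/
theorem deriv_integral_Iic {E : Type*} [NormedAddCommGroup E] [NormedSpace ℝ E] [CompleteSpace E]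
    {f : ℝ → E} (hf : ContinuousOn f (Iic 0)) (x : ℝ) (hx : x ≤ 0) :
    HasDerivWithinAt (fun x => ∫ t in x..0, f t) (-f x) (Iic 0) x := by
  have hc : Continuous fun t => f (min t 0) :=
    hf.comp_continuous (by fun_prop) fun t => min_le_right t 0
  have h1 := intervalIntegral.integral_hasDerivAt_left (hc.intervalIntegrable x 0)
    hc.stronglyMeasurable.stronglyMeasurableAtFilter hc.continuousAt
  have heq : ∀ y ≤ 0, ∫ t in y..0, f t = ∫ t in y..0, f (min t 0) := fun y hy =>
    intervalIntegral.integral_congr fun t ht => by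
      rw [uIcc_of_le hy] at ht
      simp only [min_eq_left ht.2]
  rw [min_eq_left hx] at h1
  exact h1.hasDerivWithinAt.congr heq (heq x hx)

namespace IsSolution

variable {V : ℝ → ℝ} {k : ℝ} {u v : ℝ → ℝ}

theorem deriv_sq (h : IsSolution V k u v) (x : ℝ) (hx : x ≤ 0) :
    HasDerivWithinAt (fun x => u x ^ 2) (2 * (u x * v x)) (Iic 0) x := by
  refine ((h.deriv_zeroth x hx).pow 2).congr_deriv ?_
  simp only [Nat.cast_ofNat, Nat.add_one_sub_one, pow_one]
  ring

theorem deriv_mul (h : IsSolution V k u v) (x : ℝ) (hx : x ≤ 0) :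
    HasDerivWithinAt (fun x => u x * v x) (v x ^ 2 + (V x + k) * u x ^ 2) (Iic 0) x := by
  refine ((h.deriv_zeroth x hx).mul (h.deriv_first x hx)).congr_deriv ?_
  ring

theorem monotoneOn_mul (h : IsSolution V k u v) (hV : ∀ x ≤ 0, 0 ≤ V x) (hk : 0 ≤ k) :
    MonotoneOn (fun x => u x * v x) (Iic 0) := by
  refine monotoneOn_Iic_of_deriv_nonneg h.deriv_mul fun x hx => ?_
  have := hV x hx
  positivity

/-- A solution that is not recessive blows up at `-∞`. -/
theorem eventually_le_sq (h : IsSolution V k u v) (hV : ∀ x ≤ 0, 0 ≤ V x) (hk : 0 ≤ k)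
    {y : ℝ} (hy : y ≤ 0) (hneg : u y * v y < 0) (C : ℝ) : ∀ᶠ x in atBot, C ≤ u x ^ 2 := by
  have hm := h.monotoneOn_mul hV hk
  set ε := -(u y * v y) with hε
  have hε0 : 0 < ε := by linarith
  filter_upwards [eventually_le_atBot y, eventually_le_atBot (y - C / (2 * ε))] with x hx hxC
  -- Left of `y` the product `u v` stays below `-ε`, so `(u²)' ≤ -2ε` and `u²` gains at least `2ε (y
  -- - x)`.
  have h1 := sub_le_sub_of_deriv_le hy h.deriv_sq
    (fun x _ => ((hasDerivAt_id x).const_mul (-(2 * ε))).hasDerivWithinAt) hx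
    (fun t ht => by
      have := hm (mem_Iic.2 (ht.2.le.trans hy)) hy ht.2.le
      simp only at this
      linarith)
  simp only [id] at h1
  have h2 : C / (2 * ε) * (2 * ε) = C := by field_simp
  have h3 : C / (2 * ε) * (2 * ε) ≤ (y - x) * (2 * ε) :=
    mul_le_mul_of_nonneg_right (by linarith) (by linarith)
  nlinarith [sq_nonneg (u y)]

theorem mul_nonneg_of_frequently (h : IsSolution V k u v) (hV : ∀ x ≤ 0, 0 ≤ V x) (hk : 0 ≤ k)
    {C : ℝ} (hC : ∃ᶠ x in atBot, u x ^ 2 < C) (x : ℝ) (hx : x ≤ 0) : 0 ≤ u x * v x := by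
  by_contra hneg
  refine hC ?_
  filter_upwards [h.eventually_le_sq hV hk hx (not_le.1 hneg) C] with y hy
  exact not_lt.2 hy

theorem monotoneOn_sq (h : IsSolution V k u v) (huv : ∀ x ≤ 0, 0 ≤ u x * v x) :
    MonotoneOn (fun x => u x ^ 2) (Iic 0) :=
  monotoneOn_Iic_of_deriv_nonneg h.deriv_sq fun x hx => by linarith [huv x hx]

theorem eq_zero_of_apply_zero (h : IsSolution V k u v) (huv : ∀ x ≤ 0, 0 ≤ u x * v x)
    (h0 : u 0 = 0) (x : ℝ) (hx : x ≤ 0) : u x = 0 := by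
  have := h.monotoneOn_sq huv hx (mem_Iic.2 le_rfl) hx
  simp only [h0] at this
  nlinarith [sq_nonneg (u x)]

theorem const_mul (h : IsSolution V k u v) (c : ℝ) :
    IsSolution V k (fun x => c * u x) (fun x => c * v x) where
  deriv_zeroth x hx := (h.deriv_zeroth x hx).const_mul c
  deriv_first x hx := ((h.deriv_first x hx).const_mul c).congr_deriv (by ring)

end IsSolution

/-! ### Sign, monotonicity and decay of recessive solutions -/

namespace IsRecessive

variable {V : ℝ → ℝ} {k : ℝ} {u v : ℝ → ℝ}

/-- A negative value would force a zero between it and `u 0 = 1`; since `u²` is nondecreasing, `u`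
would vanish everywhere to the left of that zero. -/
theorem nonneg (h : IsRecessive V k u v) (x : ℝ) (hx : x ≤ 0) : 0 ≤ u x := by
  by_contra hneg
  have hneg := not_le.1 hneg
  have hc : ContinuousOn u (Icc x 0) := fun y hy =>
    ((h.deriv_zeroth y hy.2).continuousWithinAt).mono fun z hz => hz.2
  obtain ⟨y, hy, hy0⟩ := intermediate_value_Icc hx hc
    (⟨hneg.le, by rw [h.apply_zero]; exact zero_le_one⟩ : (0 : ℝ) ∈ Icc (u x) (u 0))
  have := h.monotoneOn_sq h.mul_nonneg hx hy.2 hy.1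
  simp only [hy0] at this
  nlinarith

theorem monotoneOn_zeroth (h : IsRecessive V k u v) : MonotoneOn u (Iic 0) := by
  intro x hx y hy hxy
  have := h.monotoneOn_sq h.mul_nonneg hx hy hxy
  exact abs_le_of_sq_le_sq' this (h.nonneg y hy) |>.2

theorem le_one (h : IsRecessive V k u v) (x : ℝ) (hx : x ≤ 0) : u x ≤ 1 :=
  h.apply_zero ▸ h.monotoneOn_zeroth hx (mem_Iic.2 le_rfl) hx

theorem first_nonneg (h : IsRecessive V k u v) (x : ℝ) (hx : x ≤ 0) : 0 ≤ v x := by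
  have huniq : UniqueDiffWithinAt ℝ (Iic (0 : ℝ)) x := uniqueDiffOn_Iic 0 x hx
  rw [← (h.deriv_zeroth x hx).derivWithin huniq]
  exact h.monotoneOn_zeroth.derivWithin_nonneg

theorem monotoneOn_first (h : IsRecessive V k u v) (hV : ∀ x ≤ 0, 0 ≤ V x) (hk : 0 ≤ k) :
    MonotoneOn v (Iic 0) :=
  monotoneOn_Iic_of_deriv_nonneg h.deriv_first fun x hx => by
    have := hV x hx
    have := h.nonneg x hx
    positivity

/-- On `[x, 0]` one has `v' ≥ k u ≥ k u x`, hence `k u x (-x) ≤ v 0`, which gives decay like `1 /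
|x|`. -/
theorem tendsto_zeroth (h : IsRecessive V k u v) (hV : ∀ x ≤ 0, 0 ≤ V x) (hk : 0 < k) :
    Tendsto u atBot (𝓝 0) := by
  have hlim : Tendsto (fun x : ℝ => -(v 0 / k) * x⁻¹) atBot (𝓝 0) := by
    simpa using tendsto_inv_atBot_zero.const_mul (-(v 0 / k))
  refine tendsto_of_tendsto_of_tendsto_of_le_of_le' tendsto_const_nhds hlim ?_ ?_
  · filter_upwards [eventually_le_atBot 0] with x hx using h.nonneg x hx
  · filter_upwards [eventually_lt_atBot 0] with x hx
    have h1 := sub_le_sub_of_deriv_le le_rfl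
      (fun t _ => ((hasDerivAt_id t).const_mul (k * u x)).hasDerivWithinAt.congr_deriv
        (mul_one (k * u x))) h.deriv_first (f := fun t => k * u x * id t) (f' := fun _ => k * u x)
        hx.le
      (fun t ht => by
        have h2 := h.monotoneOn_zeroth hx.le (mem_Iic.2 ht.2.le) ht.1.le
        have h3 := hV t ht.2.le
        have h4 := h.nonneg t ht.2.le
        nlinarith)
    simp only [id] at h1
    have h2 := h.first_nonneg x hx.le
    have h3 : -(v 0 / k) * x⁻¹ = v 0 / (k * -x) := by
      have : x ≠ 0 := hx.ne
      field_simp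
    rw [h3, le_div_iff₀ (by nlinarith)]
    nlinarith

/-- Since `v` is nondecreasing, `v x ≤ u (x + 1) - u x ≤ u (x + 1)`. -/
theorem tendsto_first (h : IsRecessive V k u v) (hV : ∀ x ≤ 0, 0 ≤ V x) (hk : 0 < k) :
    Tendsto v atBot (𝓝 0) := by
  have hlim : Tendsto (fun x : ℝ => u (x + 1)) atBot (𝓝 0) :=
    (h.tendsto_zeroth hV hk).comp (tendsto_atBot_add_const_right _ 1 tendsto_id)
  refine tendsto_of_tendsto_of_tendsto_of_le_of_le' tendsto_const_nhds hlim ?_ ?_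
  · filter_upwards [eventually_le_atBot 0] with x hx using h.first_nonneg x hx
  · filter_upwards [eventually_le_atBot (-1)] with x hx
    have h1 := sub_le_sub_of_deriv_le (a := x) (b := x + 1) (by linarith)
      (f := fun t => v x * id t) (f' := fun _ => v x)
      (fun t _ => ((hasDerivAt_id t).const_mul (v x)).hasDerivWithinAt.congr_deriv
        (mul_one (v x))) h.deriv_zeroth (by linarith)
      (fun t ht => h.monotoneOn_first hV hk.le (mem_Iic.2 (by linarith))
        (mem_Iic.2 (by linarith [ht.2])) ht.1.le)
    simp only [id] at h1
    have := h.nonneg x (by linarith)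
    linarith

/-- The function `v² - k u²` vanishes at `-∞` and has derivative `2 V u v ≥ 0`. -/
theorem sq_le_first (h : IsRecessive V k u v) (hV : ∀ x ≤ 0, 0 ≤ V x) (hk : 0 < k)
    (x : ℝ) (hx : x ≤ 0) : k * u x ^ 2 ≤ v x ^ 2 := by
  have hd : ∀ x ≤ 0, HasDerivWithinAt (fun x => v x ^ 2 - k * u x ^ 2)
      (2 * V x * (u x * v x)) (Iic 0) x := fun x hx =>
    (((h.deriv_first x hx).pow 2).sub ((h.deriv_sq x hx).const_mul k)).congr_deriv (by
      simp only [Nat.cast_ofNat, Nat.add_one_sub_one, pow_one]; ring)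
  have hm := monotoneOn_Iic_of_deriv_nonneg hd fun x hx => by
    have := hV x hx
    have := h.mul_nonneg x hx
    positivity
  have hl : Tendsto (fun x => v x ^ 2 - k * u x ^ 2) atBot (𝓝 0) := by
    simpa using ((h.tendsto_first hV hk).pow 2).sub (((h.tendsto_zeroth hV hk).pow 2).const_mul k)
  have := le_of_tendsto_atBot hm hl x hx
  linarith

theorem le_sq (h : IsRecessive V k u v) (hV : ∀ x ≤ 0, 0 ≤ V x) (hk : 0 < k) : k ≤ v 0 ^ 2 := by
  simpa [h.apply_zero] using h.sq_le_first hV hk 0 le_rfl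

/-! ### Wronskian comparison at two energies -/

theorem deriv_wronskian {l : ℝ} {p q : ℝ → ℝ} (h : IsSolution V k u v) (h' : IsSolution V l p q)
    (x : ℝ) (hx : x ≤ 0) : HasDerivWithinAt (fun x => q x * u x - p x * v x)
      ((l - k) * (p x * u x)) (Iic 0) x :=
  (((h'.deriv_first x hx).mul (h.deriv_zeroth x hx)).sub
    ((h'.deriv_zeroth x hx).mul (h.deriv_first x hx))).congr_deriv (by ring)

theorem tendsto_wronskian {l : ℝ} {p q : ℝ → ℝ} (h : IsRecessive V k u v)
    (h' : IsRecessive V l p q) (hV : ∀ x ≤ 0, 0 ≤ V x) (hk : 0 < k) (hl : 0 < l) :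
    Tendsto (fun x => q x * u x - p x * v x) atBot (𝓝 0) := by
  simpa using ((h'.tendsto_first hV hl).mul (h.tendsto_zeroth hV hk)).sub
    ((h'.tendsto_zeroth hV hl).mul (h.tendsto_first hV hk))

/-- The Wronskian vanishes at `-∞`, is nondecreasing, and equals `q 0 - v 0` at `0`. Allowing `k =
l` also yields uniqueness of the logarithmic derivative. -/
theorem first_mono {l : ℝ} {p q : ℝ → ℝ} (h : IsRecessive V k u v) (h' : IsRecessive V l p q)
    (hV : ∀ x ≤ 0, 0 ≤ V x) (hk : 0 < k) (hkl : k ≤ l) : v 0 ≤ q 0 := by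
  have hm := monotoneOn_Iic_of_deriv_nonneg (deriv_wronskian h.1 h'.1) fun x hx =>
    _root_.mul_nonneg (sub_nonneg.2 hkl) (_root_.mul_nonneg (h'.nonneg x hx) (h.nonneg x hx))
  have := le_of_tendsto_atBot hm (h.tendsto_wronskian h' hV hk (hk.trans_le hkl)) 0 le_rfl
  simp only [h.apply_zero, h'.apply_zero] at this
  linarith

theorem first_lt {l : ℝ} {p q : ℝ → ℝ} (h : IsRecessive V k u v) (h' : IsRecessive V l p q)
    (hV : ∀ x ≤ 0, 0 ≤ V x) (hk : 0 < k) (hkl : k < l) : v 0 < q 0 := by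
  refine lt_of_le_of_ne (h.first_mono h' hV hk hkl.le) fun heq => ?_
  have hm := monotoneOn_Iic_of_deriv_nonneg (deriv_wronskian h.1 h'.1) fun x hx =>
    _root_.mul_nonneg (sub_nonneg.2 hkl.le) (_root_.mul_nonneg (h'.nonneg x hx) (h.nonneg x hx))
  -- A nondecreasing Wronskian with limit `0` and end value `0` is identically zero, yet its
  -- derivative at `0` is `l - k`.
  have hzero : ∀ x ∈ Iic (0 : ℝ), q x * u x - p x * v x = 0 := fun x hx => by
    refine le_antisymm ?_
      (le_of_tendsto_atBot hm (h.tendsto_wronskian h' hV hk (hk.trans hkl)) x hx)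
    have := hm hx (mem_Iic.2 le_rfl) hx
    simpa [h.apply_zero, h'.apply_zero, heq] using this
  have h1 := (hasDerivWithinAt_const (0 : ℝ) (Iic 0) (0 : ℝ)).congr hzero
    (hzero 0 (mem_Iic.2 le_rfl))
  have h2 := (uniqueDiffOn_Iic (0 : ℝ) 0 (mem_Iic.2 le_rfl)).eq_deriv _ h1
    (deriv_wronskian h.1 h'.1 0 le_rfl)
  rw [h.apply_zero, h'.apply_zero] at h2
  linarith

/-- This bounds the growth of the logarithmic derivative from above, which gives continuity. The
combination below vanishes at `-∞` and has derivative `(l - k) u (V + k (1 - p)) ≥ 0`, because `p ≤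
1`. -/
theorem mul_first_le {l : ℝ} {p q : ℝ → ℝ} (h : IsRecessive V k u v) (h' : IsRecessive V l p q)
    (hV : ∀ x ≤ 0, 0 ≤ V x) (hk : 0 < k) (hkl : k ≤ l) : k * q 0 ≤ l * v 0 := by
  have hd : ∀ x ≤ 0, HasDerivWithinAt (fun x => (l - k) * v x - k * (q x * u x - p x * v x))
      ((l - k) * ((V x + k) * u x) - k * ((l - k) * (p x * u x))) (Iic 0) x := fun x hx =>
    ((h.deriv_first x hx).const_mul (l - k)).sub ((deriv_wronskian h.1 h'.1 x hx).const_mul k)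
  have hm := monotoneOn_Iic_of_deriv_nonneg hd fun x hx => by
    have h1 := hV x hx
    have h2 := h.nonneg x hx
    have h3 := h'.le_one x hx
    have : (l - k) * ((V x + k) * u x) - k * ((l - k) * (p x * u x)) =
        (l - k) * u x * (V x + k * (1 - p x)) := by ring
    rw [this]
    have : 0 ≤ 1 - p x := by linarith
    have : 0 ≤ l - k := by linarith
    positivity
  have hlim : Tendsto (fun x => (l - k) * v x - k * (q x * u x - p x * v x)) atBot (𝓝 0) := by
    simpa using ((h.tendsto_first hV hk).const_mul (l - k)).sub
      ((h.tendsto_wronskian h' hV hk (hk.trans_le hkl)).const_mul k)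
  have := le_of_tendsto_atBot hm hlim 0 le_rfl
  simp only [h.apply_zero, h'.apply_zero] at this
  linarith

/-! ### Bounds on the logarithmic derivative -/

/-- The logarithmic derivative at `0` has a positive lower bound which depends only on `V`. -/
theorem exists_lower_bound (hcont : ContinuousOn V (Iic 0)) (hV : ∀ x ≤ 0, 0 ≤ V x)
    (hne : ∃ x ≤ 0, V x ≠ 0) :
    ∃ δ > 0, ∀ k u v, 0 < k → IsRecessive V k u v → δ ≤ v 0 := by
  obtain ⟨b, hb, hVb⟩ := hne
  have hpos : 0 < V b := lt_of_le_of_ne (hV b hb) (Ne.symm hVb)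
  obtain ⟨a, hab, hI⟩ : ∃ a < b, ∀ x ∈ Ioc a b, V b / 2 < V x := by
    have h1 : ∀ᶠ x in 𝓝[≤] b, V b / 2 < V x :=
      ((hcont b hb).mono (Iic_subset_Iic.2 hb)).eventually (lt_mem_nhds (half_lt_self hpos))
    obtain ⟨a, ha, hI⟩ := (mem_nhdsLE_iff_exists_Ioc_subset' (show b - 1 < b by linarith)).1 h1
    exact ⟨a, ha, hI⟩
  have ha : a < 0 := hab.trans_le hb
  -- If `v 0 < 1 / (2 |a|)`, then `v ≤ v 0` keeps `u ≥ 1/2` on `(a, 0]`. There `v' ≥ V u`, which is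
  -- at least `V b / 4` on `(a, b]`, so `v 0 ≥ v b ≥ V b / 4 * (b - a)`.
  refine ⟨min (1 / (2 * -a)) (V b / 4 * (b - a)), lt_min ?_ ?_, fun k u v hk h => ?_⟩
  · have : 0 < -a := by linarith
    positivity
  · have : 0 < b - a := by linarith
    positivity
  by_contra hlt
  obtain ⟨hlt1, hlt2⟩ := lt_min_iff.1 (not_le.1 hlt)
  rw [lt_div_iff₀ (by linarith)] at hlt1
  have hv0 := h.first_nonneg 0 le_rfl
  have hu : ∀ x ∈ Ioc a 0, 1 / 2 ≤ u x := fun x hx => by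
    have h1 := sub_le_sub_of_deriv_le le_rfl h.deriv_zeroth
      (g := fun t => v 0 * id t) (g' := fun _ => v 0)
      (fun t _ => ((hasDerivAt_id t).const_mul (v 0)).hasDerivWithinAt.congr_deriv
        (mul_one (v 0))) hx.2
      (fun t ht => h.monotoneOn_first hV hk.le (mem_Iic.2 ht.2.le) (mem_Iic.2 le_rfl) ht.2.le)
    simp only [id, h.apply_zero] at h1
    nlinarith [hx.1]
  have h2 := sub_le_sub_of_deriv_le hb
    (f := fun t => V b / 4 * id t) (f' := fun _ => V b / 4)
    (fun t _ => ((hasDerivAt_id t).const_mul (V b / 4)).hasDerivWithinAt.congr_deriv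
        (mul_one (V b / 4))) h.deriv_first hab.le
    (fun t ht => by
      have h3 := hI t ⟨ht.1, ht.2.le⟩
      have h4 := hu t ⟨ht.1, ht.2.le.trans hb⟩
      nlinarith)
  simp only [id] at h2
  have h5 := h.first_nonneg a ha.le
  have h6 := h.monotoneOn_first hV hk.le hb (mem_Iic.2 le_rfl) hb
  linarith

/-- Since `√k u ≤ v` and `u ≤ 1`, the derivative of `v - √k u` is at most `V u ≤ V`; integrate from
`-∞`, where this function vanishes. -/
theorem first_le_integral (h : IsRecessive V k u v) (hcont : ContinuousOn V (Iic 0))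
    (hV : ∀ x ≤ 0, 0 ≤ V x) (hk : 0 < k) (hint : IntegrableOn V (Iio 0)) :
    v 0 ≤ (∫ x in Iio 0, V x) + √k := by
  set I := ∫ x in Iio 0, V x with hI
  have hd : ∀ x ≤ 0, HasDerivWithinAt (fun x => v x - √k * u x) ((V x + k) * u x - √k * v x)
      (Iic 0) x := fun x hx => (h.deriv_first x hx).sub ((h.deriv_zeroth x hx).const_mul _)
  have hs : √k ^ 2 = k := Real.sq_sqrt hk.le
  have hd' : ∀ x ≤ 0, HasDerivWithinAt (fun x => -∫ t in x..0, V t) (V x) (Iic 0) x :=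
    fun x hx => (deriv_integral_Iic hcont x hx).neg.congr_deriv (neg_neg _)
  have key : ∀ x ≤ 0, v 0 - √k - I ≤ v x - √k * u x := fun x hx => by
    have h1 := sub_le_sub_of_deriv_le le_rfl hd hd' hx (fun t ht => by
      have ht0 := ht.2.le
      have h2 := h.nonneg t ht0
      have h3 := h.le_one t ht0
      have h4 := hV t ht0
      have h5 : √k * u t ≤ v t := by
        refine (abs_le_of_sq_le_sq' ?_ (h.first_nonneg t ht0)).2
        rw [mul_pow, hs]
        exact h.sq_le_first hV hk t ht0
      have h6 := mul_le_mul_of_nonneg_left h5 (Real.sqrt_nonneg k)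
      have h7 : √k * (√k * u t) = k * u t := by rw [← mul_assoc, ← sq, hs]
      nlinarith)
    have h8 : ∫ t in x..0, V t ≤ I := by
      rw [intervalIntegral.integral_of_le hx, integral_Ioc_eq_integral_Ioo]
      refine setIntegral_mono_set hint ?_ (Eventually.of_forall fun t ht => ht.2)
      exact (ae_restrict_iff' measurableSet_Iio).2 (Eventually.of_forall fun t ht => hV t (le_of_lt ht))
    simp only [h.apply_zero, intervalIntegral.integral_same] at h1
    linarith
  have hlim : Tendsto (fun x => v x - √k * u x) atBot (𝓝 0) := by
    simpa using (h.tendsto_first hV hk).sub ((h.tendsto_zeroth hV hk).const_mul (√k))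
  have := ge_of_tendsto hlim ((eventually_le_atBot 0).mono key)
  linarith

end IsRecessive


/-! ### Existence of the recessive solution by a Green kernel -/

/-- The bounded solution of `-F'' + r² F = g` on `(-∞,0]` given by the kernel
`exp (-r |x - t|) / (2 r)`. -/
def greenIntegral (r : ℝ) (g : ℝ → ℝ) (x : ℝ) : ℝ :=
  (2 * r)⁻¹ * (Real.exp (-(r * x)) * ∫ t in Iic x, Real.exp (r * t) * g t) +
    (2 * r)⁻¹ * (Real.exp (r * x) * ∫ t in x..0, Real.exp (-(r * t)) * g t)

/-- The derivative of `greenIntegral`. -/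
def greenIntegralDeriv (r : ℝ) (g : ℝ → ℝ) (x : ℝ) : ℝ :=
  -2⁻¹ * (Real.exp (-(r * x)) * ∫ t in Iic x, Real.exp (r * t) * g t) +
    2⁻¹ * (Real.exp (r * x) * ∫ t in x..0, Real.exp (-(r * t)) * g t)

variable {r : ℝ} {g : ℝ → ℝ}

theorem integrableOn_exp_mul (hr : 0 < r) (hg : Continuous g) {C : ℝ} (hC : ∀ t, |g t| ≤ C)
    (x : ℝ) : IntegrableOn (fun t => Real.exp (r * t) * g t) (Iic x) :=
  (integrableOn_exp_mul_Iic hr x).mul_bdd hg.aestronglyMeasurable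
    (Eventually.of_forall fun t => by simpa using hC t)

theorem hasDerivAt_exp_mul (c x : ℝ) :
    HasDerivAt (fun x => Real.exp (c * x)) (c * Real.exp (c * x)) x := by
  simpa [mul_comm] using ((hasDerivAt_id x).const_mul c).exp

theorem hasDerivAt_exp_mul_integral_Iic (hr : 0 < r) (hg : Continuous g) {C : ℝ}
    (hC : ∀ t, |g t| ≤ C) (x : ℝ) :
    HasDerivAt (fun x => Real.exp (-(r * x)) * ∫ t in Iic x, Real.exp (r * t) * g t)
      (-r * (Real.exp (-(r * x)) * ∫ t in Iic x, Real.exp (r * t) * g t) + g x) x := by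
  have hc : Continuous fun t => Real.exp (r * t) * g t := by fun_prop
  have h1 : HasDerivAt (fun x => ∫ t in Iic x, Real.exp (r * t) * g t) (Real.exp (r * x) * g x) x := by
    have h2 := (intervalIntegral.integral_hasDerivAt_right (hc.intervalIntegrable 0 x)
      hc.stronglyMeasurable.stronglyMeasurableAtFilter hc.continuousAt).const_add
      (∫ t in Iic 0, Real.exp (r * t) * g t)
    refine h2.congr_of_eventuallyEq (Eventually.of_forall fun y => ?_)
    have := intervalIntegral.integral_Iic_sub_Iic (integrableOn_exp_mul hr hg hC 0)
      (integrableOn_exp_mul hr hg hC y)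
    simp only [← this]
    ring
  have h3 := hasDerivAt_exp_mul (-r) x
  simp only [neg_mul] at h3 ⊢
  refine (h3.mul h1).congr_deriv ?_
  have h4 : Real.exp (-(r * x)) * Real.exp (r * x) = 1 := by rw [← Real.exp_add]; simp
  linear_combination g x * h4

theorem hasDerivAt_exp_mul_integral (hg : Continuous g) (x : ℝ) :
    HasDerivAt (fun x => Real.exp (r * x) * ∫ t in x..0, Real.exp (-(r * t)) * g t)
      (r * (Real.exp (r * x) * ∫ t in x..0, Real.exp (-(r * t)) * g t) - g x) x := by
  have hc : Continuous fun t => Real.exp (-(r * t)) * g t := by fun_prop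
  have h1 := intervalIntegral.integral_hasDerivAt_left (hc.intervalIntegrable x 0)
      hc.stronglyMeasurable.stronglyMeasurableAtFilter hc.continuousAt
  refine ((hasDerivAt_exp_mul r x).mul h1).congr_deriv ?_
  have h4 : Real.exp (r * x) * Real.exp (-(r * x)) = 1 := by rw [← Real.exp_add]; simp
  linear_combination (-g x) * h4

theorem hasDerivAt_greenIntegral (hr : 0 < r) (hg : Continuous g) {C : ℝ}
    (hC : ∀ t, |g t| ≤ C) (x : ℝ) :
    HasDerivAt (greenIntegral r g) (greenIntegralDeriv r g x) x := by
  refine (((hasDerivAt_exp_mul_integral_Iic hr hg hC x).const_mul (2 * r)⁻¹).add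
    ((hasDerivAt_exp_mul_integral hg x).const_mul (2 * r)⁻¹)).congr_deriv ?_
  rw [greenIntegralDeriv]
  field_simp
  ring

/-- The boundary terms `± g x` of the two halves cancel in the first derivative and add up to `-g x`
here. -/
theorem hasDerivAt_greenIntegralDeriv (hr : 0 < r) (hg : Continuous g) {C : ℝ}
    (hC : ∀ t, |g t| ≤ C) (x : ℝ) :
    HasDerivAt (greenIntegralDeriv r g) (r ^ 2 * greenIntegral r g x - g x) x := by
  refine (((hasDerivAt_exp_mul_integral_Iic hr hg hC x).const_mul (-2⁻¹)).add
    ((hasDerivAt_exp_mul_integral hg x).const_mul 2⁻¹)).congr_deriv ?_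
  rw [greenIntegral]
  field_simp
  ring

theorem greenIntegral_sub (hr : 0 < r) (hg : Continuous g) {C : ℝ} (hC : ∀ t, |g t| ≤ C)
    {f : ℝ → ℝ} (hf : Continuous f) {D : ℝ} (hD : ∀ t, |f t| ≤ D) (x : ℝ) :
    greenIntegral r (fun t => f t - g t) x = greenIntegral r f x - greenIntegral r g x := by
  have hcg : Continuous fun t => Real.exp (-(r * t)) * g t := by fun_prop
  have hcf : Continuous fun t => Real.exp (-(r * t)) * f t := by fun_prop
  simp only [greenIntegral, mul_sub]
  rw [integral_sub (integrableOn_exp_mul hr hf hD x) (integrableOn_exp_mul hr hg hC x),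
    intervalIntegral.integral_sub (hcf.intervalIntegrable _ _) (hcg.intervalIntegrable _ _)]
  ring

/-- Each half contributes at most `C / (2 r²)`, as the exponential prefactor cancels the size of the
integral. -/
theorem abs_greenIntegral_le (hr : 0 < r) {C : ℝ} (hC : ∀ t, |g t| ≤ C)
    (x : ℝ) (hx : x ≤ 0) : |greenIntegral r g x| ≤ C / r ^ 2 := by
  have hC0 : 0 ≤ C := (abs_nonneg _).trans (hC 0)
  have h1 : |∫ t in Iic x, Real.exp (r * t) * g t| ≤ C * (Real.exp (r * x) / r) := by
    rw [← integral_exp_mul_Iic hr, ← integral_const_mul, ← Real.norm_eq_abs]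
    refine norm_integral_le_of_norm_le ((integrableOn_exp_mul_Iic hr x).const_mul C)
      (Eventually.of_forall fun t => ?_)
    rw [Real.norm_eq_abs, abs_mul, Real.abs_exp, mul_comm]
    exact mul_le_mul_of_nonneg_right (hC t) (Real.exp_pos _).le
  have h2 : |∫ t in x..0, Real.exp (-(r * t)) * g t| ≤ C * (Real.exp (-(r * x)) / r) := by
    have h3 : ∫ t in x..0, C * Real.exp (-(r * t)) = C * ((Real.exp (-(r * x)) - 1) / r) := by
      have h4 : ∀ t ∈ uIcc x 0, HasDerivAt (fun t => -(C / r) * Real.exp (-r * t))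
          (C * Real.exp (-(r * t))) t := fun t _ => by
        refine ((hasDerivAt_exp_mul (-r) t).const_mul (-(C / r))).congr_deriv ?_
        rw [neg_mul]
        field_simp
      rw [intervalIntegral.integral_eq_sub_of_hasDerivAt h4
        (Continuous.intervalIntegrable (by fun_prop) _ _)]
      simp only [mul_zero, Real.exp_zero, neg_mul]
      field_simp
      ring
    have h5 : |∫ t in x..0, Real.exp (-(r * t)) * g t| ≤ ∫ t in x..0, C * Real.exp (-(r * t)) := by
      have hc : Continuous fun t => C * Real.exp (-(r * t)) := by fun_prop
      rw [← Real.norm_eq_abs]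
      refine intervalIntegral.norm_integral_le_of_norm_le hx (Eventually.of_forall fun t _ => ?_)
        (hc.intervalIntegrable _ _)
      rw [Real.norm_eq_abs, abs_mul, Real.abs_exp, mul_comm]
      exact mul_le_mul_of_nonneg_right (hC t) (Real.exp_pos _).le
    rw [h3] at h5
    refine h5.trans (mul_le_mul_of_nonneg_left ?_ hC0)
    gcongr
    linarith
  have h6 : Real.exp (-(r * x)) * Real.exp (r * x) = 1 := by rw [← Real.exp_add]; simp
  have h7 : |Real.exp (-(r * x)) * ∫ t in Iic x, Real.exp (r * t) * g t| ≤ C / r := by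
    rw [abs_mul, Real.abs_exp]
    refine (mul_le_mul_of_nonneg_left h1 (Real.exp_pos _).le).trans_eq ?_
    linear_combination C / r * h6
  have h8 : |Real.exp (r * x) * ∫ t in x..0, Real.exp (-(r * t)) * g t| ≤ C / r := by
    rw [abs_mul, Real.abs_exp]
    refine (mul_le_mul_of_nonneg_left h2 (Real.exp_pos _).le).trans_eq ?_
    linear_combination C / r * h6
  rw [greenIntegral, ← mul_add, abs_mul, abs_of_pos (by positivity : 0 < (2 * r)⁻¹)]
  calc (2 * r)⁻¹ * _ ≤ (2 * r)⁻¹ * (C / r + C / r) :=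
        mul_le_mul_of_nonneg_left ((abs_add_le _ _).trans (add_le_add h7 h8)) (by positivity)
    _ = C / r ^ 2 := by field_simp; ring

open scoped BoundedContinuousFunction

/-- For a bounded potential `0 ≤ W ≤ M` and `k > 0` there is a bounded solution on `(-∞,0]`,
obtained as a fixed point of a contraction. -/
theorem exists_bounded_fixedPoint {W : ℝ → ℝ} (hW : Continuous W) {M k : ℝ}
    (hW0 : ∀ t, 0 ≤ W t) (hWM : ∀ t, W t ≤ M) (hk : 0 < k) :
    ∃ f : ℝ →ᵇ ℝ, ∀ x ≤ 0, f x =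
      Real.exp (√(k + M) * x) + greenIntegral √(k + M) (fun t => (M - W t) * f t) x := by
  have hM : 0 ≤ M := (hW0 0).trans (hWM 0)
  set r := √(k + M) with hr_def
  have hr : 0 < r := Real.sqrt_pos.2 (by linarith)
  have hr2 : r ^ 2 = k + M := Real.sq_sqrt (by linarith)
  have hcont : ∀ f : ℝ →ᵇ ℝ, Continuous fun t => (M - W t) * f t := fun f =>
    (continuous_const.sub hW).mul f.continuous
  have hbd : ∀ (f : ℝ →ᵇ ℝ) t, |(M - W t) * f t| ≤ M * ‖f‖ := fun f t => by
    rw [abs_mul]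
    refine mul_le_mul ?_ (f.norm_coe_le_norm t) (abs_nonneg _) hM
    rw [abs_of_nonneg (by linarith [hWM t])]
    linarith [hW0 t]
  -- The equation is written as `-f'' + r² f = (M - W) f` with `r² = k + M`; the term `exp (r x)` is
  -- a homogeneous solution that excludes `f = 0`. Replacing `x` by `min x 0` keeps the image
  -- bounded on all of `ℝ`.
  let T : (ℝ →ᵇ ℝ) → (ℝ →ᵇ ℝ) := fun f => BoundedContinuousFunction.ofNormedAddCommGroup
    (fun x => Real.exp (r * min x 0) + greenIntegral r (fun t => (M - W t) * f t) (min x 0))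
    (by
      have h1 : Continuous (greenIntegral r fun t => (M - W t) * f t) :=
        continuous_iff_continuousAt.2 fun x =>
          (hasDerivAt_greenIntegral hr (hcont f) (hbd f) x).continuousAt
      fun_prop)
    (1 + M * ‖f‖ / r ^ 2)
    (fun x => by
      refine (norm_add_le _ _).trans (add_le_add ?_
        (abs_greenIntegral_le hr (hbd f) _ (min_le_right x 0)))
      rw [Real.norm_eq_abs, Real.abs_exp, Real.exp_le_one_iff]
      exact mul_nonpos_of_nonneg_of_nonpos hr.le (min_le_right x 0))
  have hT : ∀ f x, T f x =
    Real.exp (r * min x 0) + greenIntegral r (fun t => (M - W t) * f t) (min x 0) := fun f x => rfl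
  -- Since `0 ≤ M - W ≤ M`, the Green bound gives the Lipschitz constant `M / r² = M / (k + M) < 1`.
  have hlip : ContractingWith (Real.toNNReal (M / (k + M))) T := by
    refine ⟨?_, LipschitzWith.of_dist_le_mul fun f g => ?_⟩
    · rw [Real.toNNReal_lt_one, div_lt_one (by linarith)]
      linarith
    · rw [Real.coe_toNNReal _ (by positivity), BoundedContinuousFunction.dist_le (by positivity)]
      intro x
      rw [Real.dist_eq, hT, hT, add_sub_add_left_eq_sub,
        ← greenIntegral_sub hr (hcont g) (hbd g) (hcont f) (hbd f)]
      have h2 := abs_greenIntegral_le hr (hbd (f - g)) _ (min_le_right x 0)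
      simp only [BoundedContinuousFunction.sub_apply, mul_sub] at h2
      rw [hr2, mul_div_right_comm, ← dist_eq_norm] at h2
      exact h2
  refine ⟨hlip.fixedPoint T, fun x hx => ?_⟩
  have h := hlip.fixedPoint_isFixedPt (f := T)
  have h' := hT (hlip.fixedPoint T) x
  rw [h, min_eq_left hx] at h'
  exact h'

theorem exists_bound {V : ℝ → ℝ} (hcont : ContinuousOn V (Iic 0))
    (hlim : Tendsto V atBot (𝓝 0)) : ∃ M, ∀ x ≤ 0, V x ≤ M := by
  obtain ⟨a, ha⟩ := eventually_atBot.1 (hlim.eventually (gt_mem_nhds zero_lt_one))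
  obtain ⟨M, hM⟩ := (isCompact_Icc (a := a) (b := 0)).bddAbove_image
    (hcont.mono fun x hx => hx.2)
  refine ⟨max 1 M, fun x hx => ?_⟩
  rcases le_total x a with h | h
  · exact (ha x h).le.trans (le_max_left _ _)
  · exact (hM ⟨x, ⟨h, hx⟩, rfl⟩).trans (le_max_right _ _)

theorem exists_isRecessive {V : ℝ → ℝ} (hcont : ContinuousOn V (Iic 0))
    (hlim : Tendsto V atBot (𝓝 0)) (hV : ∀ x ≤ 0, 0 ≤ V x) {k : ℝ} (hk : 0 < k) :
    ∃ u v, IsRecessive V k u v := by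
  obtain ⟨M, hM⟩ := exists_bound hcont hlim
  have hM0 : 0 ≤ M := (hV 0 le_rfl).trans (hM 0 le_rfl)
  have hW : Continuous fun t => V (min t 0) :=
    hcont.comp_continuous (by fun_prop) fun t => min_le_right t 0
  obtain ⟨f, hf⟩ := exists_bounded_fixedPoint hW (fun t => hV _ (min_le_right t 0))
    (fun t => hM _ (min_le_right t 0)) hk
  set r := √(k + M) with hr_def
  have hr : 0 < r := Real.sqrt_pos.2 (by linarith)
  have hr2 : r ^ 2 = k + M := Real.sq_sqrt (by linarith)
  set g : ℝ → ℝ := fun t => (M - V (min t 0)) * f t with hg_def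
  have hg : Continuous g := (continuous_const.sub hW).mul f.continuous
  have hgb : ∀ t, |g t| ≤ M * ‖f‖ := fun t => by
    rw [hg_def, abs_mul]
    refine mul_le_mul ?_ (f.norm_coe_le_norm t) (abs_nonneg _) hM0
    rw [abs_of_nonneg (by linarith [hM _ (min_le_right t 0)])]
    linarith [hV _ (min_le_right t 0)]
  have hsol : IsSolution V k f (fun x => r * Real.exp (r * x) + greenIntegralDeriv r g x) := by
    refine ⟨fun x hx => ?_, fun x hx => ?_⟩
    · exact ((hasDerivAt_exp_mul r x).add
        (hasDerivAt_greenIntegral hr hg hgb x)).hasDerivWithinAt.congr hf (hf x hx)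
    · refine (((hasDerivAt_exp_mul r x).const_mul r).add
        (hasDerivAt_greenIntegralDeriv hr hg hgb x)).hasDerivWithinAt.congr_deriv ?_
      have h1 : g x = (M - V x) * f x := by rw [hg_def]; simp only [min_eq_left hx]
      have h2 := hf x hx
      rw [h1]
      linear_combination (-r ^ 2) * h2 + f x * hr2
  have hrec := hsol.mul_nonneg_of_frequently hV hk.le (C := ‖f‖ ^ 2 + 1)
    (Eventually.frequently <| Eventually.of_forall fun x => by
      have := sq_le_sq' (neg_le_of_abs_le (f.norm_coe_le_norm x))
        (le_of_abs_le (f.norm_coe_le_norm x))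
      linarith)
  -- If `f 0 = 0`, then `f` vanishes on `(-∞, 0]`, and the fixed point equation at `0` reads `0 =
  -- 1`.
  have hf0 : f 0 ≠ 0 := fun h0 => by
    have hz := hsol.eq_zero_of_apply_zero hrec h0
    have hg0 : ∀ t ≤ 0, g t = 0 := fun t ht => by simp [hg_def, hz t ht]
    have h1 := hf 0 le_rfl
    rw [h0, greenIntegral, setIntegral_congr_fun (g := fun _ => (0 : ℝ)) measurableSet_Iic
      (fun t ht => by simp only [hg0 t ht, mul_zero])] at h1
    simp at h1
  refine ⟨_, _, hsol.const_mul (f 0)⁻¹, fun x hx => ?_, inv_mul_cancel₀ hf0⟩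
  have := mul_nonneg (sq_nonneg (f 0)⁻¹) (hrec x hx)
  calc 0 ≤ _ := this
    _ = _ := by ring


/-! ### Eigenfunctions and recessive solutions -/

theorem mem_robinGraph_iff {V : ℝ → ℝ} {γ : ℝ} {p : HalfLineL2 × HalfLineL2} :
    p ∈ robinGraph V γ ↔ ∃ u v w : ℝ → ℂ, IsSecondPrimitive u v w ∧
      (∀ᵐ x ∂(volume.restrict (Iio (0 : ℝ))), p.1 x = u x) ∧
      (∀ᵐ x ∂(volume.restrict (Iio (0 : ℝ))), p.2 x = -w x + (V x : ℂ) * u x) ∧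
      v 0 = (γ : ℂ) * u 0 :=
  Iff.rfl

theorem isEigenvalue_iff {V : ℝ → ℝ} {γ : ℝ} {μ : ℂ} :
    IsEigenvalue (robinHamiltonian V γ) μ ↔
      ∃ f : HalfLineL2, f ≠ 0 ∧ (f, μ • f) ∈ robinGraph V γ := by
  rw [← robinHamiltonian_graph]
  constructor
  · rintro ⟨f, hf, h⟩
    exact ⟨f, hf, h ▸ (robinHamiltonian V γ).mem_graph f⟩
  · rintro ⟨f, hf, h⟩
    obtain ⟨y, hy, hy'⟩ := (LinearPMap.mem_graph_iff _).1 h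
    simp only at hy hy'
    subst hy
    exact ⟨y, hf, hy'⟩

theorem deriv_of_primitive {u v : ℝ → ℂ} (hv : ContinuousOn v (Iic 0))
    (h : ∀ x ≤ 0, u x = u 0 - ∫ t in x..0, v t) (x : ℝ) (hx : x ≤ 0) :
    HasDerivWithinAt u (v x) (Iic 0) x :=
  (((deriv_integral_Iic hv x hx).const_sub (u 0)).congr_deriv (neg_neg _)).congr h (h x hx)

theorem primitive_of_deriv {u v : ℝ → ℂ} (hv : ContinuousOn v (Iic 0))
    (h : ∀ x ≤ 0, HasDerivWithinAt u (v x) (Iic 0) x) (x : ℝ) (hx : x ≤ 0) :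
    u x = u 0 - ∫ t in x..0, v t := by
  rw [intervalIntegral.integral_eq_sub_of_hasDerivAt_of_le hx
    (fun y hy => ((h y hy.2).continuousWithinAt).mono fun z hz => hz.2)
    (fun y hy => (h y hy.2.le).hasDerivAt (Iic_mem_nhds hy.2))
    (intervalIntegrable_of_continuousOn hv x hx)]
  ring

theorem IsSolution.re_im {V : ℝ → ℝ} {k : ℝ} {u v : ℝ → ℂ}
    (hu : ∀ x ≤ 0, HasDerivWithinAt u (v x) (Iic 0) x)
    (hv : ∀ x ≤ 0, HasDerivWithinAt v ((V x + k) * u x) (Iic 0) x) :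
    IsSolution V k (fun x => (u x).re) (fun x => (v x).re) ∧
      IsSolution V k (fun x => (u x).im) (fun x => (v x).im) := by
  refine ⟨⟨fun x hx => ?_, fun x hx => ?_⟩, fun x hx => ?_, fun x hx => ?_⟩
  · exact Complex.reCLM.hasFDerivAt.comp_hasDerivWithinAt x (hu x hx)
  · exact (Complex.reCLM.hasFDerivAt.comp_hasDerivWithinAt x (hv x hx)).congr_deriv (by simp)
  · exact Complex.imCLM.hasFDerivAt.comp_hasDerivWithinAt x (hu x hx)
  · exact (Complex.imCLM.hasFDerivAt.comp_hasDerivWithinAt x (hv x hx)).congr_deriv (by simp)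

theorem frequently_sq_lt_of_integrableOn {u : ℝ → ℝ}
    (hu : IntegrableOn (fun x => u x ^ 2) (Iio 0)) : ∃ᶠ x in atBot, u x ^ 2 < 1 := by
  intro hev
  obtain ⟨a, ha⟩ := eventually_atBot.1 hev
  have h1 : IntegrableOn (fun _ => (1 : ℝ)) (Iio (min a 0)) := by
    refine (hu.mono_set (Iio_subset_Iio (min_le_right a 0))).mono'
      aestronglyMeasurable_const ?_
    refine (ae_restrict_iff' measurableSet_Iio).2 (Eventually.of_forall fun x hx => ?_)
    simpa using ha x ((mem_Iio.1 hx).le.trans (min_le_left a 0))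
  rw [integrableOn_const_iff] at h1
  simp at h1

theorem IsNegativeEigenvalue.exists_isRecessive {V : ℝ → ℝ} {γ E : ℝ}
    (hcont : ContinuousOn V (Iic 0)) (hV : ∀ x ≤ 0, 0 ≤ V x)
    (h : IsNegativeEigenvalue V γ E) : ∃ u v, IsRecessive V (-E) u v ∧ v 0 = γ := by
  obtain ⟨hE, h⟩ := h
  obtain ⟨f, hf, hmem⟩ := isEigenvalue_iff.1 h
  obtain ⟨u, v, w, hs, hfu, hfw, hbc⟩ := mem_robinGraph_iff.1 hmem
  simp only at hfu hfw
  have hcu := hs.continuousOn_zeroth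
  have hw : ∀ᵐ x ∂(volume.restrict (Iio (0 : ℝ))), w x = (V x + (-E : ℝ)) * u x := by
    filter_upwards [hfu, hfw, Lp.coeFn_smul (E : ℂ) f] with x h1 h2 h3
    rw [h3, Pi.smul_apply, smul_eq_mul, h1] at h2
    push_cast
    linear_combination h2
  have hcw : ContinuousOn (fun x => ((V x : ℂ) + (-E : ℝ)) * u x) (Iic 0) :=
    ((Complex.continuous_ofReal.comp_continuousOn hcont).add continuousOn_const).mul hcu
  have hdu := deriv_of_primitive hs.continuousOn_first hs.zeroth
  -- The second derivative `w` is known only almost everywhere; replacing it by the continuous `(V -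
  -- E) u` under the integral makes `v` differentiable at every point.
  have hdv := deriv_of_primitive (u := v) hcw fun x hx => by
    rw [hs.first x hx]
    congr 1
    refine intervalIntegral.integral_congr_ae ?_
    rw [uIoc_of_le hx, ← ae_restrict_iff' measurableSet_Ioc]
    rw [restrict_Iio_eq_restrict_Iic] at hw
    exact ae_restrict_of_ae_restrict_of_subset (fun t ht => ht.2) hw
  have hint : IntegrableOn (fun x => ‖u x‖ ^ 2) (Iio 0) := by
    have h1 : MemLp u 2 (volume.restrict (Iio (0 : ℝ))) := (Lp.memLp f).ae_eq hfu
    exact (memLp_two_iff_integrable_sq_norm h1.1).1 h1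
  have hk : 0 ≤ -E := by linarith
  -- A real solution dominated by a multiple of `|u|` is square integrable, hence does not blow up.
  have hpos : ∀ (c : ℝ) (p q : ℝ → ℝ), IsSolution V (-E) p q → (∀ x, |p x| ≤ c * ‖u x‖) →
      ∀ x ≤ 0, 0 ≤ p x * q x := fun c p q hpq hpu => by
    have hp : ContinuousOn p (Iic 0) := fun x hx => (hpq.deriv_zeroth x hx).continuousWithinAt
    refine hpq.mul_nonneg_of_frequently hV hk (frequently_sq_lt_of_integrableOn
      (Integrable.mono' (hint.const_mul (c ^ 2))
      ((hp.mono Iio_subset_Iic_self).pow 2 |>.aestronglyMeasurable measurableSet_Iio)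
      (Eventually.of_forall fun x => ?_)))
    rw [Real.norm_eq_abs, abs_pow, ← mul_pow]
    exact pow_le_pow_left₀ (abs_nonneg _) (hpu x) 2
  obtain ⟨hre, him⟩ := IsSolution.re_im hdu hdv
  have hre' := hpos 1 _ _ hre fun x => by simpa using Complex.abs_re_le_norm _
  have him' := hpos 1 _ _ him fun x => by simpa using Complex.abs_im_le_norm _
  have hu0 : u 0 ≠ 0 := fun h0 => hf <| by
    rw [Lp.eq_zero_iff_ae_eq_zero]
    filter_upwards [hfu, ae_restrict_mem measurableSet_Iio] with x hx hx0
    rw [hx]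
    exact Complex.ext (hre.eq_zero_of_apply_zero hre' (by simp [h0]) x (le_of_lt hx0))
      (him.eq_zero_of_apply_zero him' (by simp [h0]) x (le_of_lt hx0))
  -- After division by the complex number `u 0`, the real part has value `1` and derivative `γ` at
  -- `0`.
  have hsol := (IsSolution.re_im (V := V) (k := -E) (fun x hx => (hdu x hx).const_mul (u 0)⁻¹)
    fun x hx => ((hdv x hx).const_mul (u 0)⁻¹).congr_deriv (by ring)).1
  refine ⟨_, _, ⟨hsol, hpos ‖(u 0)⁻¹‖ _ _ hsol fun x => ?_, ?_⟩, ?_⟩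
  · exact (Complex.abs_re_le_norm _).trans_eq (norm_mul _ _)
  · simp [hu0]
  · have : (u 0)⁻¹ * v 0 = γ := by rw [hbc]; field_simp
    simp [this]

theorem IsRecessive.isNegativeEigenvalue {V : ℝ → ℝ} {k : ℝ} {u v : ℝ → ℝ}
    (h : IsRecessive V k u v) (hcont : ContinuousOn V (Iic 0)) (hV : ∀ x ≤ 0, 0 ≤ V x)
    (hk : 0 < k) : IsNegativeEigenvalue V (v 0) (-k) := by
  have hcu : ContinuousOn u (Iic 0) := fun x hx => (h.deriv_zeroth x hx).continuousWithinAt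
  have hcv : ContinuousOn v (Iic 0) := fun x hx => (h.deriv_first x hx).continuousWithinAt
  have hcU : ContinuousOn (fun x => (u x : ℂ)) (Iic 0) :=
    Complex.continuous_ofReal.comp_continuousOn hcu
  have hcV : ContinuousOn (fun x => (v x : ℂ)) (Iic 0) :=
    Complex.continuous_ofReal.comp_continuousOn hcv
  have hcW : ContinuousOn (fun x => (((V x + k) * u x : ℝ) : ℂ)) (Iic 0) :=
    Complex.continuous_ofReal.comp_continuousOn ((hcont.add continuousOn_const).mul hcu)
  -- Square integrability: `(u v)' ≥ k u²` and `u v ≥ 0` give `k ∫ u² ≤ v 0` on every `[x, 0]`.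
  have hle : ∀ x ≤ 0, ∫ t in x..0, u t ^ 2 ≤ v 0 / k := fun x hx => by
    have h1 := sub_le_sub_of_deriv_le le_rfl
      (fun x hx => ((deriv_integral_Iic (hcu.pow 2) x hx).neg.const_mul k)) h.deriv_mul hx
      (fun t ht => by
        have h2 := hV t ht.2.le
        simp only [neg_neg, Pi.pow_apply]
        nlinarith [sq_nonneg (v t), sq_nonneg (u t), _root_.mul_nonneg h2 (sq_nonneg (u t))])
    have h2 := h.mul_nonneg x hx
    simp only [h.apply_zero, Pi.neg_apply, Pi.pow_apply, intervalIntegral.integral_same] at h1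
    rw [le_div_iff₀ hk]
    linarith
  have hint : IntegrableOn (fun x => u x ^ 2) (Iio 0) := by
    rw [← integrableOn_Iic_iff_integrableOn_Iio]
    refine integrableOn_Iic_of_intervalIntegral_norm_bounded (v 0 / k) 0 (a := id) (fun i => ?_)
      tendsto_id ((eventually_le_atBot 0).mono fun x hx => ?_)
    · refine ((hcu.pow 2).mono fun y (hy : y ∈ Icc i 0) => hy.2).integrableOn_Icc.mono_set
        Ioc_subset_Icc_self
    · simpa using hle x hx
  have hmem : MemLp (fun x => (u x : ℂ)) 2 (volume.restrict (Iio (0 : ℝ))) := by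
    rw [memLp_two_iff_integrable_sq_norm
      ((hcU.mono Iio_subset_Iic_self).aestronglyMeasurable measurableSet_Iio)]
    simpa [IntegrableOn] using hint
  have hdU : ∀ x ≤ 0, HasDerivWithinAt (fun x => (u x : ℂ)) (v x : ℂ) (Iic 0) x := fun x hx =>
    (h.deriv_zeroth x hx).ofReal_comp
  have hdV : ∀ x ≤ 0, HasDerivWithinAt (fun x => (v x : ℂ)) (((V x + k) * u x : ℝ) : ℂ)
    (Iic 0) x := fun x hx => (h.deriv_first x hx).ofReal_comp
  refine ⟨by linarith, isEigenvalue_iff.2 ⟨hmem.toLp _, fun h0 => ?_, mem_robinGraph_iff.2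
    ⟨fun x => (u x : ℂ), fun x => (v x : ℂ), fun x => (((V x + k) * u x : ℝ) : ℂ),
      ⟨intervalIntegrable_of_continuousOn hcW, primitive_of_deriv hcW hdV,
        primitive_of_deriv hcV hdU⟩, hmem.coeFn_toLp, ?_, by simp [h.apply_zero]⟩⟩⟩
  · have h1 : ∀ᵐ x ∂(volume.restrict (Iio (0 : ℝ))), (u x : ℂ) = 0 := by
      filter_upwards [hmem.coeFn_toLp, (Lp.eq_zero_iff_ae_eq_zero).1 h0] with x h2 h3
      rw [← h2, h3, Pi.zero_apply]
    have := eq_zero_of_ae_eq_zero hcU h1 0 le_rfl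
    simp [h.apply_zero] at this
  · filter_upwards [hmem.coeFn_toLp, Lp.coeFn_smul ((-k : ℝ) : ℂ) (hmem.toLp _)] with x h1 h2
    simp only [h2, Pi.smul_apply, h1, smul_eq_mul]
    push_cast
    ring

end RobinHalfLine

end

theorem RobinHalfLine.isNegativeEigenvalue_iff {V : ℝ → ℝ} (hcont : ContinuousOn V (Iic 0))
    (hV : ∀ x ≤ 0, 0 ≤ V x) {γ E : ℝ} :
    IsNegativeEigenvalue V γ E ↔ E < 0 ∧ ∃ u v, IsRecessive V (-E) u v ∧ v 0 = γ := by
  refine ⟨fun h => ⟨h.1, h.exists_isRecessive hcont hV⟩, ?_⟩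
  rintro ⟨hE, u, v, h, rfl⟩
  simpa using h.isNegativeEigenvalue hcont hV (neg_pos.2 hE)

/-! ### The function `m` and the critical Robin parameter -/

/-- The logarithmic derivative at `0` of the decaying solution is a continuous increasing function
of `k = -E`; its infimum is the critical Robin parameter. -/
theorem RobinHalfLine.exists_logDeriv {V : ℝ → ℝ} (hcont : ContinuousOn V (Iic 0))
    (hlim : Tendsto V atBot (𝓝 0)) (hV : ∀ x ≤ 0, 0 ≤ V x) :
    ∃ m : ℝ → ℝ, (∀ k > 0, ∃ u v, IsRecessive V k u v ∧ v 0 = m k) ∧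
      StrictMonoOn m (Ioi 0) ∧ ContinuousOn m (Ioi 0) ∧
      ∀ γ E, IsNegativeEigenvalue V γ E ↔ E < 0 ∧ m (-E) = γ := by
  choose! u v huv using fun k (hk : 0 < k) => exists_isRecessive hcont hlim hV hk
  have hmono : StrictMonoOn (fun k => v k 0) (Ioi 0) := fun k hk l hl hkl =>
    (huv k hk).first_lt (huv l hl) hV hk hkl
  refine ⟨fun k => v k 0, fun k hk => ⟨_, _, huv k hk, rfl⟩, hmono, ?_, fun γ E => ?_⟩
  · intro k hk
    have hk : 0 < k := hk
    -- Monotonicity of `m` and of `m k / k` place `m l` between `m k` and `(l / k) m k`, in an order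
    -- that depends on the side of `k`.
    have hlow : Tendsto (fun l => min (v k 0) (l / k * v k 0)) (𝓝 k) (𝓝 (v k 0)) := by
      have : Continuous fun l => min (v k 0) (l / k * v k 0) := by fun_prop
      simpa [hk.ne'] using this.tendsto k
    have hupp : Tendsto (fun l => max (v k 0) (l / k * v k 0)) (𝓝 k) (𝓝 (v k 0)) := by
      have : Continuous fun l => max (v k 0) (l / k * v k 0) := by fun_prop
      simpa [hk.ne'] using this.tendsto k
    suffices ContinuousAt (fun k => v k 0) k from this.continuousWithinAt
    refine tendsto_of_tendsto_of_tendsto_of_le_of_le' hlow hupp ?_ ?_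
    all_goals
      filter_upwards [lt_mem_nhds hk] with l hl
      rw [div_mul_eq_mul_div]
      rcases le_total k l with hkl | hkl
    · exact min_le_of_left_le (hmono.monotoneOn hk hl hkl)
    · refine min_le_of_right_le ((div_le_iff₀ hk).2 ?_)
      linarith [(huv l hl).mul_first_le (huv k hk) hV hl hkl]
    · refine le_max_of_le_right ((le_div_iff₀ hk).2 ?_)
      linarith [(huv k hk).mul_first_le (huv l hl) hV hk hkl]
    · exact le_max_of_le_left (hmono.monotoneOn hl hk hkl)
  · rw [isNegativeEigenvalue_iff hcont hV]
    refine and_congr_right fun hE => ⟨?_, fun h => ⟨_, _, huv _ (neg_pos.2 hE), h⟩⟩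
    rintro ⟨p, q, h, rfl⟩
    have hk := neg_pos.2 hE
    exact le_antisymm ((huv _ hk).first_mono h hV hk le_rfl) (h.first_mono (huv _ hk) hV hk le_rfl)

theorem proposition5 (V : ℝ → ℝ)
    (hcont : ContinuousOn V (Iic 0))
    (hlim : Tendsto V atBot (𝓝 0))
    (hnonneg : ∀ x ≤ 0, 0 ≤ V x) :
    -- small Robin parameters
    ((∃ x ≤ 0, V x ≠ 0) →
      ∃ γ₀ > 0, ∀ γ, 0 < γ → γ < γ₀ → ¬ ∃ E, RobinHalfLine.IsNegativeEigenvalue V γ E) ∧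
    ∃ γc : ℝ, 0 ≤ γc ∧
      -- the critical value
      ((∃ x ≤ 0, V x ≠ 0) → 0 < γc) ∧
      {γ : ℝ | ∃ E, RobinHalfLine.IsNegativeEigenvalue V γ E} = Ioi γc ∧
      -- the negative eigenvalue is unique and obeys the bound
      (∀ γ > γc, ∃ E, RobinHalfLine.IsNegativeEigenvalue V γ E ∧ |E| ≤ 2 * γ ^ 2 ∧
        ∀ E', RobinHalfLine.IsNegativeEigenvalue V γ E' → E' = E) ∧
      -- potentials with finite integral
      (IntegrableOn V (Iio 0) → γc ≤ 2 * ∫ x in Iio 0, V x) := by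
  obtain ⟨m, hm, hmono, hmcont, hiff⟩ := RobinHalfLine.exists_logDeriv hcont hlim hnonneg
  have hm0 : ∀ k > 0, 0 ≤ m k := fun k hk => by
    obtain ⟨u, v, h, h'⟩ := hm k hk
    exact h' ▸ h.first_nonneg 0 le_rfl
  have hsq : ∀ k > 0, k ≤ m k ^ 2 := fun k hk => by
    obtain ⟨u, v, h, h'⟩ := hm k hk
    exact h' ▸ h.le_sq hnonneg hk
  have hbdd : BddBelow (m '' Ioi 0) := ⟨0, by rintro _ ⟨k, hk, rfl⟩; exact hm0 k hk⟩
  have hne : (m '' Ioi 0).Nonempty := ⟨m 1, 1, mem_Ioi.2 one_pos, rfl⟩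
  set γc := sInf (m '' Ioi 0) with hγc
  have hle : ∀ k > 0, γc ≤ m k := fun k hk => csInf_le hbdd ⟨k, hk, rfl⟩
  -- Strict monotonicity on the open half line prevents the infimum from being attained.
  have hlt : ∀ k > 0, γc < m k := fun k hk =>
    (hle (k / 2) (half_pos hk)).trans_lt (hmono (mem_Ioi.2 (half_pos hk)) hk (half_lt_self hk))
  have hsurj : ∀ γ > γc, ∃ k > 0, m k = γ := fun γ hγ => by
    obtain ⟨_, ⟨k, hk, rfl⟩, hkγ⟩ := exists_lt_of_csInf_lt hne hγ
    -- At `k = γ² + 1` the bound `k ≤ m k ^ 2` gives `m k ≥ γ`, so the intermediate value theorem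
    -- applies; the `+ 1` keeps `k` positive when `γ = 0`.
    have hl : 0 < γ ^ 2 + 1 := by positivity
    have hγl : γ ≤ m (γ ^ 2 + 1) :=
      (abs_le_of_sq_le_sq' ((le_add_of_nonneg_right zero_le_one).trans (hsq _ hl)) (hm0 _ hl)).2
    have := hmcont.surjOn_uIcc hk hl (Icc_subset_uIcc ⟨hkγ.le, hγl⟩)
    obtain ⟨x, hx, hxγ⟩ := this
    exact ⟨x, hx, hxγ⟩
  have hset : {γ : ℝ | ∃ E, RobinHalfLine.IsNegativeEigenvalue V γ E} = Ioi γc := by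
    ext γ
    simp only [hiff, mem_ofPred_eq, mem_Ioi]
    constructor
    · rintro ⟨E, hE, rfl⟩
      exact hlt _ (neg_pos.2 hE)
    · intro hγ
      obtain ⟨k, hk, rfl⟩ := hsurj γ hγ
      exact ⟨-k, neg_lt_zero.2 hk, by rw [neg_neg]⟩
  have hpos : (∃ x ≤ 0, V x ≠ 0) → 0 < γc := fun hV => by
    obtain ⟨δ, hδ, h⟩ := RobinHalfLine.IsRecessive.exists_lower_bound hcont hnonneg hV
    refine hδ.trans_le (le_csInf hne ?_)
    rintro _ ⟨k, hk, rfl⟩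
    obtain ⟨u, v, huv, hmk⟩ := hm k hk
    exact hmk ▸ h k u v hk huv
  refine ⟨fun hV => ⟨γc, hpos hV, fun γ _ hγ hE => ?_⟩, γc, ?_, hpos, hset, fun γ hγ => ?_,
    fun hint => ?_⟩
  · exact hγ.not_gt (hset.subset hE)
  · exact le_csInf hne (by rintro _ ⟨k, hk, rfl⟩; exact hm0 k hk)
  · obtain ⟨k, hk, rfl⟩ := hsurj γ hγ
    refine ⟨-k, (hiff _ _).2 ⟨neg_lt_zero.2 hk, by rw [neg_neg]⟩, ?_, fun E' hE' => ?_⟩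
    · rw [abs_neg, abs_of_pos hk]
      linarith [hsq k hk, sq_nonneg (m k)]
    · obtain ⟨hE, h⟩ := (hiff _ _).1 hE'
      rw [← hmono.injOn (neg_pos.2 hE) hk h, neg_neg]
  · have hI : 0 ≤ ∫ x in Iio 0, V x :=
      setIntegral_nonneg measurableSet_Iio fun x hx => hnonneg x (le_of_lt hx)
    -- Taking `k = ε²` turns the error `√k` into `ε`; this gives the bound without the factor `2`.
    have hbound : γc ≤ ∫ x in Iio 0, V x := by
      refine le_of_forall_pos_le_add fun ε hε => ?_
      obtain ⟨u, v, h, h'⟩ := hm (ε ^ 2) (by positivity)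
      have h1 := h.first_le_integral hcont hnonneg (by positivity) hint
      rw [Real.sqrt_sq hε.le, h'] at h1
      exact (hle _ (by positivity)).trans h1
    linarith
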